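/- Let $S$ be a set and let $n\ge 2$ be an integer. A quandle $(X,*)$ is an $n$-quandle if $x*\underbrace{y*\cdots*y}_{n}=x$ (bracketed to the left) for all $x,y\in X$; a free $n$-quandle $FQ_n(S)$ on $S$ is an $n$-quandle containing $S$ such that every map from $S$ to an $n$-quandle $X$ extends uniquely to a quandle homomorphism $FQ_n(S)\to X$; and a quandle $X$ is residually finite if for all $x\neq y$ in $X$ there are a finite quandle $Q$ and a quandle homomorphism $\varphi:X\to Q$ with $\varphi(x)\ne\varphi(y)$. Let $G=\ast_{s\in S}\,\langle a_s\mid a_s^n=1\rangle$ be the free product of cyclic groups of order $n$, one for each element of $S$, and let $\operatorname{Conj}(G)$ be the quandle on the set $G$ with $x*y=y^{-1}xy$. Then: 1. the group $G$ is residually finite; 2. every free $n$-quandle $FQ_n(S)$ on $S$ is a residually finite quandle; 3. there is an injective quandle homomorphism $FQ_n(S)\to\operatorname{Conj}(G)$ sending each $s\in S$ to $a_s$, and its image is the set of all conjugates in $G$ of the generators $a_s$, $s\in S$. -/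

import Mathlib

/-!
Quandles are Mathlib's, written with a left action. A right quandle operation `x * y` corresponds
to `y ◃⁻¹ x`; on `Quandle.Conj G` this is `y⁻¹ * x * y`. Homomorphisms are the maps `→◃`, which
preserve both `◃` and `◃⁻¹`.
-/

universe u v w

open scoped Quandles

/-- An `n`-quandle: every inner translation has order dividing `n`. (The translation `y ◃⁻¹ ·` is
the inverse of `y ◃ ·`, so it does not matter which of the two is iterated.) -/
def IsNQuandle (n : ℕ) (X : Type u) [Quandle X] : Prop :=
  ∀ y x : X, (fun z => y ◃ z)^[n] x = x

/-- `F`, with the inclusion `ι : S → F`, is a free `n`-quandle on `S`. -/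
structure IsFreeNQuandle (n : ℕ) {S : Type u} {F : Type v} [Quandle F] (ι : S → F) : Prop where
  isNQuandle : IsNQuandle n F
  injective : Function.Injective ι
  existsUnique_extend : ∀ (X : Type (max u v)) [Quandle X], IsNQuandle n X →
    ∀ φ : S → X, ∃! ψ : F →◃ X, ∀ s, ψ (ι s) = φ s

/-- A subset `A` of a quandle is separable if every point outside `A` can be kept outside the image
of `A` by a homomorphism to a finite quandle. (Every finite quandle is isomorphic to one in
`Type`.) -/
def Quandle.IsSeparable {X : Type u} [Quandle X] (A : Set X) : Prop :=
  ∀ x, x ∉ A → ∃ (Q : Type) (_ : Quandle Q) (_ : Finite Q) (φ : X →◃ Q), φ x ∉ φ '' A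

/-- A quandle is residually finite if its one-point subsets are separable. -/
def Quandle.IsResiduallyFinite (X : Type u) [Quandle X] : Prop :=
  ∀ x : X, Quandle.IsSeparable ({x} : Set X)

/-- The free product of cyclic groups of order `n`, one for each element of `S`. -/
abbrev CyclicFreeProduct (n : ℕ) (S : Type u) : Type u :=
  Monoid.CoprodI (fun _ : S => Multiplicative (ZMod n))

/-- The generator of the `s`-th factor. -/
def CyclicFreeProduct.gen (n : ℕ) {S : Type u} (s : S) : CyclicFreeProduct n S :=
  Monoid.CoprodI.of (M := fun _ : S => Multiplicative (ZMod n)) (i := s)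
    (Multiplicative.ofAdd (1 : ZMod n))

/-! ### A free `n`-quandle exists: formal expressions modulo the `n`-quandle laws -/

/-- Formal quandle expressions in the elements of `S`. -/
inductive QuandleTerm (S : Type u) : Type u
  | of (s : S) : QuandleTerm S
  | act (a b : QuandleTerm S) : QuandleTerm S
  | invAct (a b : QuandleTerm S) : QuandleTerm S

/-- The congruence generated by the laws of an `n`-quandle. -/
inductive QuandleTerm.Rel (n : ℕ) {S : Type u} : QuandleTerm S → QuandleTerm S → Prop
  | refl (a) : Rel n a a
  | symm {a b} : Rel n a b → Rel n b a
  | trans {a b c} : Rel n a b → Rel n b c → Rel n a c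
  | act_congr {a a' b b'} : Rel n a a' → Rel n b b' → Rel n (.act a b) (.act a' b')
  | invAct_congr {a a' b b'} : Rel n a a' → Rel n b b' → Rel n (.invAct a b) (.invAct a' b')
  | self_distrib (a b c) : Rel n (.act a (.act b c)) (.act (.act a b) (.act a c))
  | left_inv (a b) : Rel n (.invAct a (.act a b)) b
  | right_inv (a b) : Rel n (.act a (.invAct a b)) b
  | fix (a) : Rel n (.act a a) a
  | iterate (a b) : Rel n ((QuandleTerm.act a)^[n] b) b

/-- The congruence as a setoid. -/
def QuandleTerm.setoid (n : ℕ) (S : Type u) : Setoid (QuandleTerm S) where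
  r := QuandleTerm.Rel n
  iseqv := ⟨.refl, .symm, .trans⟩

/-- The free `n`-quandle on `S`, constructed as a quotient of the formal quandle expressions. -/
def FreeNQuandle (n : ℕ) (S : Type u) : Type u :=
  Quotient (QuandleTerm.setoid n S)

namespace FreeNQuandle

variable {n : ℕ} {S : Type u}

/-- The class of an expression. -/
def mk (n : ℕ) (a : QuandleTerm S) : FreeNQuandle n S :=
  Quotient.mk (QuandleTerm.setoid n S) a

/-- The canonical inclusion of the generators. -/
def of (n : ℕ) (s : S) : FreeNQuandle n S := mk n (.of s)

theorem mk_eq {a b : QuandleTerm S} (h : QuandleTerm.Rel n a b) : mk n a = mk n b :=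
  Quotient.sound (s := QuandleTerm.setoid n S) h

theorem ind {p : FreeNQuandle n S → Prop} (h : ∀ a, p (mk n a)) (x : FreeNQuandle n S) : p x :=
  Quotient.ind h x

instance : Quandle (FreeNQuandle n S) where
  act := Quotient.map₂ QuandleTerm.act fun _ _ h _ _ h' => .act_congr h h'
  invAct := Quotient.map₂ QuandleTerm.invAct fun _ _ h _ _ h' => .invAct_congr h h'
  self_distrib := by
    intro x y z
    induction x using ind
    induction y using ind
    induction z using ind
    exact mk_eq (.self_distrib _ _ _)
  left_inv := by
    intro x y
    induction x using ind
    induction y using ind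
    exact mk_eq (.left_inv _ _)
  right_inv := by
    intro x y
    induction x using ind
    induction y using ind
    exact mk_eq (.right_inv _ _)
  fix := by
    intro x
    induction x using ind
    exact mk_eq (.fix _)

theorem mk_act (a b : QuandleTerm S) : mk n (.act a b) = mk n a ◃ mk n b := rfl

theorem mk_invAct (a b : QuandleTerm S) : mk n (.invAct a b) = mk n a ◃⁻¹ mk n b := rfl

theorem isNQuandle : IsNQuandle n (FreeNQuandle n S) := by
  have key : ∀ (a b : QuandleTerm S) (k : ℕ),
      (fun z => mk n a ◃ z)^[k] (mk n b) = mk n ((QuandleTerm.act a)^[k] b) := by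
    intro a b k
    induction k generalizing b with
    | zero => rfl
    | succ k ih => exact ih (.act a b)
  intro y x
  induction y using ind
  induction x using ind
  rw [key]
  exact mk_eq (.iterate _ _)

section lift

variable {X : Type w} [Quandle X]

/-- Evaluation of an expression in a quandle. -/
def interpret (φ : S → X) : QuandleTerm S → X
  | .of s => φ s
  | .act a b => interpret φ a ◃ interpret φ b
  | .invAct a b => interpret φ a ◃⁻¹ interpret φ b

theorem interpret_eq (hX : IsNQuandle n X) (φ : S → X) {a b : QuandleTerm S}
    (h : QuandleTerm.Rel n a b) : interpret φ a = interpret φ b := by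
  induction h with
  | refl => rfl
  | symm _ ih => exact ih.symm
  | trans _ _ ih ih' => exact ih.trans ih'
  | act_congr _ _ ih ih' => simp only [interpret, ih, ih']
  | invAct_congr _ _ ih ih' => simp only [interpret, ih, ih']
  | self_distrib => exact Shelf.self_distrib
  | left_inv a b => exact Rack.left_inv _ _
  | right_inv a b => exact Rack.right_inv _ _
  | fix => exact Quandle.fix
  | iterate a b =>
    have key : ∀ (b : QuandleTerm S) (k : ℕ), interpret φ ((QuandleTerm.act a)^[k] b)
        = (fun z => interpret φ a ◃ z)^[k] (interpret φ b) := by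
      intro b k
      induction k generalizing b with
      | zero => rfl
      | succ k ih => exact ih (.act a b)
    rw [key]
    exact hX _ _

/-- The extension of a map on generators to a homomorphism. -/
def lift (hX : IsNQuandle n X) (φ : S → X) : FreeNQuandle n S →◃ X where
  toFun := Quotient.lift (interpret φ) fun _ _ h => interpret_eq hX φ h
  map_act' := by
    intro x y
    induction x using ind
    induction y using ind
    rfl

theorem lift_of (hX : IsNQuandle n X) (φ : S → X) (s : S) : lift hX φ (of n s) = φ s := rfl

theorem hom_ext {f g : FreeNQuandle n S →◃ X} (h : ∀ s, f (of n s) = g (of n s)) : f = g := by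
  have map_inv : ∀ (k : FreeNQuandle n S →◃ X) (x y : FreeNQuandle n S),
      k (x ◃⁻¹ y) = k x ◃⁻¹ k y := by
    intro k x y
    rw [← Rack.left_cancel (k x), ← ShelfHom.map_act, Rack.act_invAct_eq, Rack.act_invAct_eq]
  refine DFunLike.ext _ _ fun x => ?_
  induction x using ind with
  | h a =>
    induction a with
    | of s => exact h s
    | act a b iha ihb => rw [mk_act, ShelfHom.map_act, ShelfHom.map_act, iha, ihb]
    | invAct a b iha ihb => rw [mk_invAct, map_inv, map_inv, iha, ihb]

end lift

theorem of_injective : Function.Injective (of n : S → FreeNQuandle n S) := by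
  letI : Quandle S :=
    { act := fun _ y => y
      self_distrib := rfl
      invAct := fun _ y => y
      left_inv := fun _ _ => rfl
      right_inv := fun _ _ => rfl
      fix := rfl }
  have hS : IsNQuandle n S := fun y x => by
    change (fun z : S => z)^[n] x = x
    exact congrFun (Function.iterate_id n) x
  exact Function.LeftInverse.injective (g := lift hS id) fun s => lift_of hS id s

/-- The constructed object is a free `n`-quandle. -/
theorem isFreeNQuandle : IsFreeNQuandle n (of n : S → FreeNQuandle n S) where
  isNQuandle := isNQuandle
  injective := of_injective
  existsUnique_extend := fun _ _ hX φ =>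
    ⟨lift hX φ, lift_of hX φ, fun _ h => hom_ext fun s => h s⟩

end FreeNQuandle

/-! Let `G` act on the free `n`-quandle with each generator `a_s` acting as the inner translation by
`s`. Every element is `g • s`, and the map to `Conj G` is equivariant for conjugation, so its image
is the set of conjugates of the `a_s`. If `g • s` and `k • t` have the same image, `k⁻¹ * g`
conjugates `a_s` to `a_t`. A homomorphism to `ZMod n` gives `s = t`; the centralizer of `a_s`
consists of its powers (`mem_range_of_of_commute`), and these fix `s` since `s ◃ s = s`. Hence `g •
s = k • s`.

Both facts about free products come from altering left multiplication factor by factor, which the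
universal property permits. Truncating it to a finite set gives residual finiteness
(`exists_perm_fin_ne_one`), which passes to the quandle by injectivity; making one factor act
trivially on itself gives the centralizer. -/

open Classical in
/-- Given a permutation action of `H` on `Y`, a subset `X` and an invariant subset `A ⊆ X`, the
action of `H` on `X` which agrees with the given one on `A` and is trivial off `A`. -/
noncomputable def Equiv.Perm.restrictHom {H Y : Type*} [Group H] (φ : H →* Equiv.Perm Y)
    (X A : Set Y) (hAX : ∀ y ∈ A, y ∈ X) (hA : ∀ h, ∀ y ∈ A, φ h y ∈ A) : H →* Equiv.Perm X :=
  MonoidHom.toHomPerm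
    { toFun := fun h x => if hx : x.1 ∈ A then ⟨φ h x.1, hAX _ (hA h _ hx)⟩ else x
      map_one' := by
        funext x
        simp [Function.End.one_def]
      map_mul' := fun g h => by
        funext x
        change _ = dite ((dite _ _ _ : X).1 ∈ A) _ _
        by_cases hx : x.1 ∈ A <;> simp [hx, hA h] }

theorem Equiv.Perm.restrictHom_apply_of_mem {H Y : Type*} [Group H] (φ : H →* Equiv.Perm Y)
    {X A : Set Y} (hAX : ∀ y ∈ A, y ∈ X) (hA : ∀ h, ∀ y ∈ A, φ h y ∈ A) (h : H) {x : X} (hx : x.1 ∈ A) :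
    (Equiv.Perm.restrictHom φ X A hAX hA h x : Y) = φ h x :=
  congrArg Subtype.val (dif_pos hx)

theorem Equiv.Perm.restrictHom_apply_of_notMem {H Y : Type*} [Group H] (φ : H →* Equiv.Perm Y)
    {X A : Set Y} (hAX : ∀ y ∈ A, y ∈ X) (hA : ∀ h, ∀ y ∈ A, φ h y ∈ A) (h : H) {x : X} (hx : x.1 ∉ A) :
    Equiv.Perm.restrictHom φ X A hAX hA h x = x :=
  dif_neg hx

/-! ### Free products: finite permutation representations and centralizers -/

namespace Monoid.CoprodI

variable {ι : Type*} {M : ι → Type*} [∀ i, Group (M i)]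

/-- The action of a free factor on the free product by left multiplication. -/
def leftMulHom (M : ι → Type*) [∀ i, Group (M i)] (i : ι) : M i →* Equiv.Perm (CoprodI M) :=
  (MulAction.toPermHom (CoprodI M) (CoprodI M)).comp of

theorem leftMulHom_apply {i : ι} (m : M i) (g : CoprodI M) : leftMulHom M i m g = of m * g := rfl

/-- The action of the free product on a subset `X` of itself in which a free factor acts by left
multiplication on those of its orbits that are contained in `X`, and trivially elsewhere. -/
noncomputable def truncatedHom (X : Set (CoprodI M)) : CoprodI M →* Equiv.Perm X :=
  lift fun i => Equiv.Perm.restrictHom (leftMulHom M i) X {g | ∀ m : M i, of m * g ∈ X}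
    (fun g hg => by simpa using hg 1)
    (fun h g hg m => by
      rw [leftMulHom_apply, ← mul_assoc, ← map_mul]
      exact hg _)

/-- Write `g` as a product of factor elements. `Y` collects, for each proper suffix, its orbit under
the factor of the next letter. Once `X` contains these orbits, each letter acts as true left
multiplication along the path from `1` to `g`. -/
theorem exists_finite_truncatedHom_apply [∀ i, Finite (M i)] (g : CoprodI M) :
    ∃ Y : Set (CoprodI M), Y.Finite ∧ ∀ X, Y ⊆ X → ∀ h : 1 ∈ X,
      (truncatedHom X g ⟨1, h⟩ : CoprodI M) = g := by
  induction g using CoprodI.induction_left with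
  | one => exact ⟨∅, Set.finite_empty, fun X _ h => by simp⟩
  | mul m g ih =>
    rename_i i
    obtain ⟨Y, hY, hg⟩ := ih
    refine ⟨Y ∪ Set.range fun m : M i => of m * g, hY.union (Set.finite_range _), fun X hX h => ?_⟩
    obtain ⟨hYX, hgX⟩ := Set.union_subset_iff.1 hX
    have hg' := hg X hYX h
    rw [map_mul, Equiv.Perm.mul_apply, truncatedHom, lift_of,
      Equiv.Perm.restrictHom_apply_of_mem, leftMulHom_apply, ← truncatedHom, hg']
    rw [← truncatedHom, Set.mem_ofPred_eq, hg']
    exact fun m => hgX ⟨m, rfl⟩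

/-- In a free product of finite groups, nontrivial elements are detected by finite permutation
representations. -/
theorem exists_perm_fin_ne_one [∀ i, Finite (M i)] {g : CoprodI M} (hg : g ≠ 1) :
    ∃ (k : ℕ) (φ : CoprodI M →* Equiv.Perm (Fin k)), φ g ≠ 1 := by
  obtain ⟨Y, hY, h⟩ := exists_finite_truncatedHom_apply g
  have hX : (insert 1 Y).Finite := hY.insert 1
  have := hX.to_subtype
  obtain ⟨k, ⟨e⟩⟩ := Finite.exists_equiv_fin (insert 1 Y : Set (CoprodI M))
  refine ⟨k, e.permCongrHom.toMonoidHom.comp (truncatedHom _), fun h1 => hg ?_⟩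
  have h2 : truncatedHom (insert 1 Y) g = 1 := by
    apply e.permCongrHom.injective
    exact h1.trans (map_one e.permCongrHom).symm
  -- The truncated action of `g` carries `1` to `g`, so acting trivially forces `g = 1`.
  have h3 := h _ (Set.subset_insert 1 Y) (Set.mem_insert 1 Y)
  rw [← h3, h2, Equiv.Perm.one_apply]

instance residuallyFinite [∀ i, Finite (M i)] : Group.ResiduallyFinite (CoprodI M) := by
  rw [Group.residuallyFinite_iff_exists_finiteIndex]
  intro g hg
  obtain ⟨k, φ, hφ⟩ := exists_perm_fin_ne_one hg
  exact ⟨φ.ker, inferInstance, by simpa using hφ⟩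

/-- The action of the free product on itself by left multiplication, modified so that the `i`-th
factor acts trivially on itself. -/
noncomputable def modifiedHom (i : ι) : CoprodI M →* Equiv.Perm (Set.univ : Set (CoprodI M)) :=
  lift fun j => Equiv.Perm.restrictHom (leftMulHom M j) Set.univ
    {g | j = i → g ∉ (of (M := M) (i := i)).range} (fun g _ => Set.mem_univ g)
    (fun h g hg => by
      rintro rfl
      simpa [leftMulHom_apply, Subgroup.mul_mem_cancel_left] using hg rfl)

/-- The only moves suppressed are those of the `i`-th factor on itself, and they stay within a
single coset. -/
theorem mk_modifiedHom_apply (i : ι) (g : CoprodI M) (y : (Set.univ : Set (CoprodI M))) :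
    ((modifiedHom i g y : CoprodI M) : CoprodI M ⧸ (of (M := M) (i := i)).range)
      = ((g * y.1 : CoprodI M) : CoprodI M ⧸ (of (M := M) (i := i)).range) := by
  induction g using CoprodI.induction_left with
  | one => simp
  | mul m g ih =>
    rename_i j
    rw [map_mul, Equiv.Perm.mul_apply, mul_assoc]
    generalize modifiedHom i g y = z at ih
    have hz : ((of m * z.1 : CoprodI M) : CoprodI M ⧸ (of (M := M) (i := i)).range)
        = ((of m * (g * y.1) : CoprodI M) : CoprodI M ⧸ (of (M := M) (i := i)).range) := by
      rw [QuotientGroup.eq] at ih ⊢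
      simpa [mul_assoc] using ih
    rw [← hz, modifiedHom, lift_of]
    by_cases h : z.1 ∈ {g | j = i → g ∉ (of (M := M) (i := i)).range}
    · rw [Equiv.Perm.restrictHom_apply_of_mem _ _ _ _ h, leftMulHom_apply]
    · rw [Equiv.Perm.restrictHom_apply_of_notMem _ _ _ _ h]
      rw [Set.mem_ofPred_eq, Classical.not_imp, not_not] at h
      obtain ⟨rfl, h⟩ := h
      rw [QuotientGroup.eq]
      exact mul_mem (inv_mem h) (mul_mem ⟨m, rfl⟩ h)

/-- In the modified action the fixed points of `of m` are exactly the elements of the `i`-th factor,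
since elsewhere it acts by left multiplication. An element commuting with `of m` preserves this set,
hence carries `1` into the factor; modulo the factor, that image is `g`. -/
theorem mem_range_of_of_commute {i : ι} {m : M i} (hm : m ≠ 1) {g : CoprodI M}
    (h : Commute g (of m)) : g ∈ (of (M := M) (i := i)).range := by
  have hm' : of (M := M) m ≠ 1 := fun h => hm (of_injective i (h.trans (map_one _).symm))
  have key (z : (Set.univ : Set (CoprodI M))) :
      modifiedHom i (of m) z = z ↔ z.1 ∈ (of (M := M) (i := i)).range := by
    rw [modifiedHom, lift_of]
    by_cases hz : z.1 ∈ {g | i = i → g ∉ (of (M := M) (i := i)).range}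
    · rw [Subtype.ext_iff, Equiv.Perm.restrictHom_apply_of_mem _ _ _ _ hz, leftMulHom_apply]
      simpa [hm'] using hz
    · rw [Equiv.Perm.restrictHom_apply_of_notMem _ _ _ _ hz]
      simpa using hz
  have h1 : modifiedHom i (of m) (modifiedHom i g ⟨1, trivial⟩) = modifiedHom i g ⟨1, trivial⟩ := by
    rw [← Equiv.Perm.mul_apply, ← map_mul, ← h.eq, map_mul, Equiv.Perm.mul_apply,
      (key ⟨1, trivial⟩).2 (one_mem _)]
  have h2 := mk_modifiedHom_apply i g ⟨1, trivial⟩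
  rw [mul_one, QuotientGroup.eq] at h2
  exact (Subgroup.mul_mem_cancel_left _ (inv_mem ((key _).1 h1))).1 h2

end Monoid.CoprodI

/-! ### Uniqueness of the free `n`-quandle -/

instance ULift.quandle {X : Type u} [Quandle X] : Quandle (ULift.{v} X) where
  act x y := ⟨x.down ◃ y.down⟩
  self_distrib := congrArg ULift.up Shelf.self_distrib
  invAct x y := ⟨x.down ◃⁻¹ y.down⟩
  left_inv _ _ := congrArg ULift.up (Rack.left_inv _ _)
  right_inv _ _ := congrArg ULift.up (Rack.right_inv _ _)
  fix := congrArg ULift.up Quandle.fix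

/-- `ULift.up` as a homomorphism of shelves. -/
def ShelfHom.up (X : Type u) [Quandle X] : X →◃ ULift.{v} X where
  toFun := ULift.up
  map_act' := rfl

/-- `ULift.down` as a homomorphism of shelves. -/
def ShelfHom.down (X : Type u) [Quandle X] : ULift.{v} X →◃ X where
  toFun := ULift.down
  map_act' := rfl

theorem IsNQuandle.ulift {n : ℕ} {X : Type u} [Quandle X] (h : IsNQuandle n X) :
    IsNQuandle n (ULift.{v} X) := by
  intro y x
  have key (k : ℕ) (x : ULift.{v} X) :
      ((fun z => y ◃ z)^[k] x).down = (fun z => y.down ◃ z)^[k] x.down := by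
    induction k generalizing x with
    | zero => rfl
    | succ k ih => exact ih _
  exact ULift.ext _ _ ((key n x).trans (h _ _))

theorem IsNQuandle.act'_pow {n : ℕ} {X : Type u} [Quandle X] (h : IsNQuandle n X) (x : X) :
    Rack.act' x ^ n = 1 := by
  ext y
  rw [← Equiv.Perm.iterate_eq_pow]
  exact h x y

/-- Any free `n`-quandle is isomorphic to the standard one. -/
theorem IsFreeNQuandle.exists_bijective {n : ℕ} {S : Type u} {F : Type v} [Quandle F] {ι : S → F}
    (h : IsFreeNQuandle n ι) :
    ∃ e : F →◃ FreeNQuandle n S, Function.Bijective e ∧ ∀ s, e (ι s) = FreeNQuandle.of n s := by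
  -- The universal property only tests quandles in universe `max u v`, so both the comparison map
  -- and the uniqueness argument pass through `ULift`.
  obtain ⟨ψ, hψ, -⟩ := h.existsUnique_extend (ULift.{v} (FreeNQuandle n S))
    FreeNQuandle.isNQuandle.ulift fun s => ⟨FreeNQuandle.of n s⟩
  let e : F →◃ FreeNQuandle n S := (ShelfHom.down _).comp ψ
  have he (s : S) : e (ι s) = FreeNQuandle.of n s := congrArg ULift.down (hψ s)
  let e' : FreeNQuandle n S →◃ F := FreeNQuandle.lift h.isNQuandle ι
  have h1 : (ShelfHom.up.{v, u} F).comp (e'.comp e) = ShelfHom.up F :=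
    (h.existsUnique_extend (ULift.{u} F) h.isNQuandle.ulift fun s => ⟨ι s⟩).unique
      (fun s => congrArg ULift.up (congrArg e' (he s))) (fun _ => rfl)
  have h2 : e.comp e' = ShelfHom.id _ := FreeNQuandle.hom_ext he
  exact ⟨e, ⟨Function.LeftInverse.injective (g := e')
      fun x => congrArg ULift.down (DFunLike.congr_fun h1 x),
    Function.RightInverse.surjective (g := e') fun x => DFunLike.congr_fun h2 x⟩, he⟩

/-- The quandle of elements of a group whose order divides `n`, under conjugation. -/
def Quandle.TorsionConj (n : ℕ) (G : Type*) [Group G] : Type _ := {g : G // g ^ n = 1}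

namespace Quandle.TorsionConj

variable (n : ℕ) (G : Type*) [Group G]

instance : Quandle (TorsionConj n G) where
  act x y := ⟨x.1 * y.1 * x.1⁻¹, by rw [conj_pow, y.2]; simp⟩
  self_distrib := Subtype.ext (by simp [mul_assoc])
  invAct x y := ⟨x.1⁻¹ * y.1 * x.1, by
    simpa [y.2] using conj_pow (i := n) (a := x.1⁻¹) (b := y.1)⟩
  left_inv _ _ := Subtype.ext (by simp [mul_assoc])
  right_inv _ _ := Subtype.ext (by simp [mul_assoc])
  fix := Subtype.ext (by simp)

/-- The inclusion into the conjugation quandle. -/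
def incl : TorsionConj n G →◃ Conj G where
  toFun := Subtype.val
  map_act' := rfl

theorem isNQuandle : IsNQuandle n (TorsionConj n G) := by
  intro y x
  have key (k : ℕ) (x : TorsionConj n G) :
      ((fun z => y ◃ z)^[k] x).1 = y.1 ^ k * x.1 * (y.1 ^ k)⁻¹ := by
    induction k generalizing x with
    | zero => simp
    | succ k ih =>
      refine (ih _).trans ?_
      change y.1 ^ k * (y.1 * x.1 * y.1⁻¹) * _ = _
      simp [pow_succ, mul_assoc]
  exact Subtype.ext (by rw [key, y.2]; simp)

end Quandle.TorsionConj

/-! ### Free products of cyclic groups -/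

namespace CyclicFreeProduct

variable {n : ℕ} {S : Type u}

theorem gen_pow (s : S) : gen n s ^ n = 1 := by
  rw [gen, ← map_pow, ← ofAdd_nsmul]
  simp

theorem of_ofAdd_intCast (s : S) (k : ℤ) :
    Monoid.CoprodI.of (M := fun _ : S => Multiplicative (ZMod n)) (i := s)
      (Multiplicative.ofAdd (k : ZMod n)) = gen n s ^ k := by
  rw [gen, ← map_zpow, ← ofAdd_zsmul]
  simp

@[elab_as_elim]
theorem induction {p : CyclicFreeProduct n S → Prop} (one : p 1)
    (gen_mul : ∀ s g, p g → p (gen n s * g)) (gen_inv_mul : ∀ s g, p g → p ((gen n s)⁻¹ * g))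
    (g : CyclicFreeProduct n S) : p g := by
  induction g using Monoid.CoprodI.induction_left with
  | one => exact one
  | mul m g ih =>
    rename_i s
    obtain ⟨k, hk⟩ := ZMod.intCast_surjective m.toAdd
    have hm : m = Multiplicative.ofAdd (k : ZMod n) := by rw [hk]; rfl
    rw [hm, of_ofAdd_intCast]
    induction k using Int.induction_on generalizing m with
    | zero => simpa using ih
    | succ k ih' =>
      rw [add_comm, zpow_add, zpow_one, mul_assoc]
      exact gen_mul _ _ (ih' _ rfl rfl)
    | pred k ih' =>
      rw [sub_eq_neg_add, zpow_add, zpow_neg_one, mul_assoc]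
      exact gen_inv_mul _ _ (ih' _ rfl rfl)

/-- The homomorphism to a group which sends the generators to given elements. -/
def liftOfPow {H : Type*} [Group H] (φ : S → H) (hφ : ∀ s, φ s ^ n = 1) :
    CyclicFreeProduct n S →* H :=
  Monoid.CoprodI.lift fun s => AddMonoidHom.toMultiplicativeLeft
    (ZMod.lift n ⟨(zmultiplesHom (Additive H)) (Additive.ofMul (φ s)), by
      simpa using congrArg Additive.ofMul (hφ s)⟩)

theorem liftOfPow_gen {H : Type*} [Group H] (φ : S → H) (hφ : ∀ s, φ s ^ n = 1) (s : S) :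
    liftOfPow φ hφ (gen n s) = φ s := by
  rw [liftOfPow, gen, Monoid.CoprodI.lift_of]
  have := ZMod.lift_coe n ⟨(zmultiplesHom (Additive H)) (Additive.ofMul (φ s)), by
      simpa using congrArg Additive.ofMul (hφ s)⟩ 1
  rw [Int.cast_one] at this
  simpa using congrArg Additive.toMul this

/-- The character `χ` to `ZMod n` counting occurrences of `s` is constant on conjugacy classes; it
separates `s` from any other generator because `1 ≠ 0` in `ZMod n`. -/
theorem gen_eq_of_isConj (hn : 2 ≤ n) {s t : S} (h : IsConj (gen n s) (gen n t)) : s = t := by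
  classical
  have : Fact (1 < n) := ⟨hn⟩
  by_contra hst
  let χ : CyclicFreeProduct n S →* Multiplicative (ZMod n) :=
    liftOfPow (fun r => if r = s then Multiplicative.ofAdd 1 else 1) fun r => by
      split_ifs
      · rw [← ofAdd_nsmul]; simp
      · simp
  have h1 := isConj_iff_eq.1 (χ.map_isConj h)
  simp only [χ, liftOfPow_gen, if_true, if_neg (Ne.symm hst)] at h1
  exact one_ne_zero (α := ZMod n) (Multiplicative.ofAdd.injective h1)

theorem exists_zpow_of_commute (hn : 2 ≤ n) {s : S} {g : CyclicFreeProduct n S}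
    (h : Commute g (gen n s)) : ∃ k : ℤ, g = gen n s ^ k := by
  have : Fact (1 < n) := ⟨hn⟩
  obtain ⟨m, rfl⟩ := Monoid.CoprodI.mem_range_of_of_commute
    (fun h => one_ne_zero (α := ZMod n) (Multiplicative.ofAdd.injective h)) h
  obtain ⟨k, hk⟩ := ZMod.intCast_surjective m.toAdd
  exact ⟨k, by rw [← of_ofAdd_intCast, hk]; rfl⟩

end CyclicFreeProduct

/-! ### The equivariant embedding into the conjugation quandle -/

namespace FreeNQuandle

variable {n : ℕ} {S : Type u}

/-- The action of the free product of cyclic groups on the free `n`-quandle, in which a generator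
acts by the corresponding inner translation. -/
def permHom (n : ℕ) (S : Type u) : CyclicFreeProduct n S →* Equiv.Perm (FreeNQuandle n S) :=
  CyclicFreeProduct.liftOfPow (fun s => Rack.act' (of n s)) fun _ => isNQuandle.act'_pow _

theorem permHom_gen (s : S) :
    permHom n S (CyclicFreeProduct.gen n s) = Rack.act' (of n s) :=
  CyclicFreeProduct.liftOfPow_gen _ _ s

theorem permHom_gen_zpow_of (s : S) (k : ℤ) :
    permHom n S (CyclicFreeProduct.gen n s ^ k) (of n s) = of n s := by
  rw [map_zpow, permHom_gen]
  exact Equiv.Perm.zpow_apply_eq_self_of_apply_eq_self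
    (Quandle.fix : of n s ◃ of n s = of n s) k

/-- The homomorphism to the conjugation quandle of the free product of cyclic groups. -/
def toConj (n : ℕ) (S : Type u) : FreeNQuandle n S →◃ Quandle.Conj (CyclicFreeProduct n S) :=
  (Quandle.TorsionConj.incl n _).comp
    -- The full conjugation quandle need not be an `n`-quandle, so the lift goes to the elements
    -- with `g ^ n = 1`.
    (lift (Quandle.TorsionConj.isNQuandle n _)
      fun s => ⟨CyclicFreeProduct.gen n s, CyclicFreeProduct.gen_pow s⟩)

theorem toConj_of (s : S) : toConj n S (of n s) = CyclicFreeProduct.gen n s := rfl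

/-- Both sides turn `◃` into conjugation of permutations, and they agree on generators. -/
theorem permHom_toConj (x : FreeNQuandle n S) : permHom n S (toConj n S x) = Rack.act' x := by
  induction x using ind with
  | h a =>
    induction a with
    | of s => exact permHom_gen s
    | act a b iha ihb =>
      rw [mk_act, ShelfHom.map_act, Quandle.conj_act_eq_conj, map_mul, map_mul, map_inv, iha, ihb,
        Rack.ad_conj]
    | invAct a b iha ihb =>
      -- Rewriting `b` this way turns its induction hypothesis into an equation between conjugates
      -- by the translation of `a`, which then cancels.
      have h : mk n b = mk n a ◃ (mk n a ◃⁻¹ mk n b) := (Rack.right_inv _ _).symm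
      rw [h, ShelfHom.map_act, Quandle.conj_act_eq_conj, map_mul, map_mul, map_inv, iha,
        Rack.ad_conj] at ihb
      exact mul_left_cancel (mul_right_cancel ihb)

/-- Translation by any `a` is the action of `toConj a`, so descending through right-hand arguments
of an expression ends at a generator. -/
theorem exists_permHom_of (x : FreeNQuandle n S) : ∃ g s, x = permHom n S g (of n s) := by
  induction x using ind with
  | h a =>
    induction a with
    | of s => exact ⟨1, s, by rw [map_one]; rfl⟩
    | act a b _ ihb =>
      obtain ⟨g, s, hg⟩ := ihb
      exact ⟨toConj n S (mk n a) * g, s, by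
        rw [map_mul, permHom_toConj, Equiv.Perm.mul_apply, ← hg]; rfl⟩
    | invAct a b _ ihb =>
      obtain ⟨g, s, hg⟩ := ihb
      exact ⟨(toConj n S (mk n a) : CyclicFreeProduct n S)⁻¹ * g, s, by
        rw [map_mul, map_inv, permHom_toConj, Equiv.Perm.mul_apply, ← hg]; rfl⟩

theorem toConj_permHom (g : CyclicFreeProduct n S) (x : FreeNQuandle n S) :
    toConj n S (permHom n S g x) = (g * toConj n S x * g⁻¹ : CyclicFreeProduct n S) := by
  have key (s : S) (y : FreeNQuandle n S) : toConj n S (permHom n S (CyclicFreeProduct.gen n s) y)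
      = (CyclicFreeProduct.gen n s * toConj n S y * (CyclicFreeProduct.gen n s)⁻¹ :
        CyclicFreeProduct n S) := by
    rw [permHom_gen, Rack.act'_apply, ShelfHom.map_act, Quandle.conj_act_eq_conj, toConj_of]
  induction g using CyclicFreeProduct.induction with
  | one => simp
  | gen_mul s g ih =>
    rw [map_mul, Equiv.Perm.mul_apply, key, ih]
    group
  | gen_inv_mul s g ih =>
    -- The inverse case follows by applying `key` at the point already moved by the inverse, then
    -- solving for its image.
    have h := key s (permHom n S ((CyclicFreeProduct.gen n s)⁻¹ * g) x)
    rw [← Equiv.Perm.mul_apply, ← map_mul, mul_inv_cancel_left, ih] at h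
    rw [← inv_mul_eq_iff_eq_mul.2 (eq_mul_inv_iff_mul_eq.1 h), mul_inv_rev, inv_inv]
    simp only [mul_assoc]

theorem toConj_injective (hn : 2 ≤ n) : Function.Injective (toConj n S) := by
  intro x y h
  obtain ⟨g, s, rfl⟩ := exists_permHom_of x
  obtain ⟨k, t, rfl⟩ := exists_permHom_of y
  rw [toConj_permHom, toConj_permHom, toConj_of, toConj_of] at h
  have h' : k⁻¹ * g * CyclicFreeProduct.gen n s * (k⁻¹ * g)⁻¹ = CyclicFreeProduct.gen n t := by
    rw [mul_inv_rev, inv_inv, ← mul_assoc, mul_assoc k⁻¹, mul_assoc k⁻¹, h]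
    group
  obtain rfl := CyclicFreeProduct.gen_eq_of_isConj hn (isConj_iff.2 ⟨_, h'⟩)
  obtain ⟨m, hm⟩ := CyclicFreeProduct.exists_zpow_of_commute hn (mul_inv_eq_iff_eq_mul.1 h')
  rw [inv_mul_eq_iff_eq_mul] at hm
  -- Now `g = k * gen n s ^ m`, and the power of the generator fixes `of n s`.
  rw [hm, map_mul, Equiv.Perm.mul_apply, permHom_gen_zpow_of]

theorem range_toConj : Set.range (toConj n S) =
    {g | ∃ s : S, IsConj (CyclicFreeProduct.gen n s) g} := by
  ext g
  constructor
  · rintro ⟨x, rfl⟩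
    obtain ⟨k, s, rfl⟩ := exists_permHom_of x
    exact ⟨s, isConj_iff.2 ⟨k, (toConj_permHom k (of n s)).symm⟩⟩
  · rintro ⟨s, h⟩
    obtain ⟨k, rfl⟩ := isConj_iff.1 h
    exact ⟨permHom n S k (of n s), toConj_permHom k (of n s)⟩

end FreeNQuandle

/-! ### Residual finiteness and the main theorem -/

theorem Quandle.isResiduallyFinite_of_injective_coprodI {X : Type v} [Quandle X] {ι : Type*}
    {M : ι → Type*} [∀ i, Group (M i)] [∀ i, Finite (M i)]
    (f : X →◃ Quandle.Conj (Monoid.CoprodI M)) (hf : Function.Injective f) :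
    Quandle.IsResiduallyFinite X := by
  intro y x hxy
  -- A finite permutation representation detecting this quotient separates `f x` from `f y`.
  have hne : (f x : Monoid.CoprodI M) * (f y : Monoid.CoprodI M)⁻¹ ≠ 1 :=
    fun h => hxy (hf (mul_inv_eq_one.1 h))
  obtain ⟨k, φ, hφ⟩ := Monoid.CoprodI.exists_perm_fin_ne_one hne
  refine ⟨Quandle.Conj (Equiv.Perm (Fin k)), inferInstance,
    inferInstanceAs (Finite (Equiv.Perm (Fin k))), (Quandle.Conj.map φ).comp f, ?_⟩
  rw [Set.image_singleton, Set.mem_singleton_iff]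
  intro h
  refine hφ ?_
  rw [map_mul, map_inv, mul_inv_eq_one]
  exact h

theorem mainTheorem11 (n : ℕ) (hn : 2 ≤ n) (S : Type u) :
    Group.ResiduallyFinite (CyclicFreeProduct n S) ∧
    ∀ (F : Type v) [Quandle F] (ι : S → F), IsFreeNQuandle n ι →
      Quandle.IsResiduallyFinite F ∧
      ∃ f : F →◃ Quandle.Conj (CyclicFreeProduct n S),
        Function.Injective f ∧
        (∀ s, f (ι s) = CyclicFreeProduct.gen n s) ∧
        Set.range f = {g | ∃ s : S, IsConj (CyclicFreeProduct.gen n s) g} := by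
  have : NeZero n := ⟨by omega⟩
  have : Finite (Multiplicative (ZMod n)) := inferInstanceAs (Finite (ZMod n))
  refine ⟨inferInstance, fun F _ ι h => ?_⟩
  obtain ⟨e, he, heι⟩ := h.exists_bijective
  have hinj : Function.Injective ((FreeNQuandle.toConj n S).comp e) :=
    (FreeNQuandle.toConj_injective hn).comp he.1
  refine ⟨Quandle.isResiduallyFinite_of_injective_coprodI _ hinj, _, hinj, fun s => ?_, ?_⟩
  · rw [ShelfHom.comp_apply, heι, FreeNQuandle.toConj_of]
  · rw [← FreeNQuandle.range_toConj]
    exact he.2.range_comp (FreeNQuandle.toConj n S)
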